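/- Let $p$ be an odd prime, let $f=\exp\left(x+\frac{x^p}{p}\right)\in\mathbb{Q}_p[[x]]$ be the Dwork exponential, and for a formal Laurent series $g=\sum_{n\in\mathbb{Z}}a_nx^n$ over $\mathbb{Q}_p$ put $[g]_0=a_0$ and $$D_x\,g=\sum_{i\ge 0}\partial_x^i\,(x^{-1}g),$$ the sum being taken coefficientwise in the $p$-adic topology. Let $\omega$ be the Teichmüller character, $\langle n\rangle=n/\omega(n)$, and let $$L_p(s,\chi)=\frac{1}{s-1}\lim_{k\to\infty}\frac{1}{p^{k+1}}\sum_{\substack{1\le n\le p^{k+1}\\ p\nmid n}}\chi(n)\langle n\rangle^{1-s}$$ be the Kubota–Leopoldt $p$-adic $L$-function ($s\in\mathbb{Z}_p$, $s\neq 1$, $\chi$ a power of $\omega$). For integers $s\ge 2$ denote by $\zeta_p(s)=\frac{p^s}{p^s-1}L_p(s,\omega^{1-s})$ the $p$-adic zeta values. Then all the series defining the iterates $D_x^sf$ ($s\ge 1$) converge, the limit defining $L_p(3,\omega^{-2})$ exists, and $$\Delta_3:=[D_x^3f]_0-\frac{[D_xf]_0^3}{3!}=\frac{L_p(3,\omega^{-2})}{3}=\left(1-\frac1{p^3}\right)\frac{\zeta_p(3)}{3}.$$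 Consequently $$p^3\,\frac{24}{25}\,\Delta_3=p^3\,\frac{2^3}{5^2}\,L_p(3,\omega^{-2})=(p^3-1)\,\frac{2^3}{5^2}\,\zeta_p(3).$$ -/

import Mathlib

open Filter Topology

noncomputable section

namespace DworkGamma

/-! ### Laurent series, the operator `D_x`, and the Dwork exponential -/

/-- A formal two-sided Laurent series `∑_{n ∈ ℤ} a_n x^n` over `ℚ_p`, given by its coefficients. -/
abbrev Laurent (p : ℕ) [Fact p.Prime] : Type := ℤ → ℚ_[p]

/-- A power series, seen as a Laurent series without negative powers of `x`. -/
def ofPowerSeries {p : ℕ} [Fact p.Prime] (g : PowerSeries ℚ_[p]) : Laurent p :=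
  fun n => if 0 ≤ n then PowerSeries.coeff n.toNat g else 0

/-- The formal derivative `∂_x`. -/
def pderiv {p : ℕ} [Fact p.Prime] (a : Laurent p) : Laurent p :=
  fun n => ((n + 1 : ℤ) : ℚ_[p]) * a (n + 1)

/-- Multiplication by `x⁻¹`. -/
def divX {p : ℕ} [Fact p.Prime] (a : Laurent p) : Laurent p :=
  fun n => a (n + 1)

/-- The differential operator of infinite order `∑_{i ≥ 0} ∂_x^i`; the sum is taken coefficientwise,
in the `p`-adic topology. -/
def derivSum {p : ℕ} [Fact p.Prime] (a : Laurent p) : Laurent p :=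
  fun n => ∑' i : ℕ, (pderiv^[i] a) n

/-- The operator `D_x = (∑_{i ≥ 0} ∂_x^i) ∘ x⁻¹`, so that for instance `[D_x x^k]_0 = (k - 1)!`
for `k ≥ 1`. -/
def Dx {p : ℕ} [Fact p.Prime] (a : Laurent p) : Laurent p :=
  derivSum (divX a)

/-- `[g]_0`, the coefficient of `x^0`. -/
def constTerm {p : ℕ} [Fact p.Prime] (a : Laurent p) : ℚ_[p] := a 0

/-- The Dwork exponential `f = exp (x + x^p / p)`. -/
def dworkExp (p : ℕ) [Fact p.Prime] : PowerSeries ℚ_[p] :=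
  (PowerSeries.exp ℚ_[p]).subst
    (PowerSeries.X + PowerSeries.C ((p : ℚ_[p])⁻¹) * PowerSeries.X ^ p : PowerSeries ℚ_[p])

/-- `D_x^s f` for the Dwork exponential `f`. -/
def DxPowDwork (p : ℕ) [Fact p.Prime] (s : ℕ) : Laurent p :=
  Dx^[s] (ofPowerSeries (dworkExp p))

/-- `Δ_s = [D_x^s f]_0 - [D_x f]_0^s / s!`. -/
def Delta (p : ℕ) [Fact p.Prime] (s : ℕ) : ℚ_[p] :=
  constTerm (DxPowDwork p s) - constTerm (DxPowDwork p 1) ^ s / (s.factorial : ℚ_[p])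

/-! ### The Teichmüller character and the Kubota–Leopoldt `p`-adic `L`-function -/

/-- The Teichmüller character `ω`, as a Dirichlet character modulo `p` with values in `ℤ_p`:
`ω(a)` is the Teichmüller representative of `a` under the identification of the Witt vectors of
`𝔽_p` with `ℤ_p`. -/
def teichmullerChar (p : ℕ) [Fact p.Prime] : DirichletCharacter ℤ_[p] p where
  toFun a := WittVector.equiv p (WittVector.teichmuller p a)
  map_one' := by simp
  map_mul' a b := by simp
  map_nonunit' a ha := by
    have h : a = 0 := by
      by_contra h
      exact ha (isUnit_iff_ne_zero.mpr h)
    simp [h]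

/-- `⟨n⟩ = n / ω(n) ∈ 1 + p ℤ_p`, for an integer `n` prime to `p`. -/
def angle (p : ℕ) [Fact p.Prime] (n : ℕ) : ℤ_[p] :=
  (n : ℤ_[p]) * (teichmullerChar p)⁻¹ (n : ZMod p)

/-- `u ^ t = ∑_k binom(t, k) (u - 1)^k` for `u ∈ 1 + p ℤ_p` and `t ∈ ℤ_p`. -/
def unitPow {p : ℕ} [Fact p.Prime] (u t : ℤ_[p]) : ℤ_[p] :=
  PadicInt.mahlerSeries (fun k : ℕ => (u - 1) ^ k) t

/-- The `k`-th approximation `p^{-(k+1)} ∑_{1 ≤ n ≤ p^{k+1}, p ∤ n} χ(n) ⟨n⟩^{1-s}` to the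
Volkenborn integral of `χ(t) ⟨t⟩^{1-s}` over `ℤ_p^×`. -/
def volkenbornSum (p : ℕ) [Fact p.Prime] (s : ℤ_[p]) (χ : DirichletCharacter ℤ_[p] p) (k : ℕ) :
    ℚ_[p] :=
  ((p : ℚ_[p]) ^ (k + 1))⁻¹ *
    ∑ n ∈ (Finset.Icc 1 (p ^ (k + 1))).filter (fun n => ¬ p ∣ n),
      ((χ (n : ZMod p) * unitPow (angle p n) (1 - s) : ℤ_[p]) : ℚ_[p])

/-- The Kubota–Leopoldt `p`-adic `L`-function
`L_p(s, χ) = (s - 1)⁻¹ lim_k p^{-(k+1)} ∑_{1 ≤ n ≤ p^{k+1}, p ∤ n} χ(n) ⟨n⟩^{1-s}`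
for `s ∈ ℤ_p`, `s ≠ 1`, and a Dirichlet character `χ` modulo `p` (a power of `ω`). -/
def kubotaLeopoldt (p : ℕ) [Fact p.Prime] (s : ℤ_[p]) (χ : DirichletCharacter ℤ_[p] p) : ℚ_[p] :=
  ((s : ℚ_[p]) - 1)⁻¹ * limUnder atTop (volkenbornSum p s χ)

/-- The `p`-adic zeta value `ζ_p(s)`, `s ≥ 2`: the value `L_p(s, ω^{1-s})` with the Euler factor
`1 - p^{-s}` restored, `ζ_p(s) = p^s / (p^s - 1) * L_p(s, ω^{1-s})`. -/
def padicZeta (p : ℕ) [Fact p.Prime] (s : ℕ) : ℚ_[p] :=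
  (p : ℚ_[p]) ^ s / ((p : ℚ_[p]) ^ s - 1) *
    kubotaLeopoldt p (s : ℤ_[p]) (teichmullerChar p ^ (1 - (s : ℤ)))

end DworkGamma

end

/-!
Attach to a Laurent series `∑ a_n x^n` the sequence `b n = n! a_n`. On these sequences `D_x` acts by
the tail sums `T b n = ∑_{m > n} b m / m`, so `g_s := [D_x^s f]_0` is the value at `0` of `T^s b`,
where `b` is the sequence of the Dwork exponential `f`. Write
`A_s(N) = ∑ (-1)^n binom(N, n) (T^s b) n`. Summation by parts gives `A_s(N) = g_s - N A_{s+1}(N)`,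
and `b` decays fast enough for `A_s(N) → g_s` as `N` tends `p`-adically to `0`. The ratio
`A_0(2N) / A_0(N)²` thus has an expansion in powers of `N` whose coefficients are polynomials in the
`g_s`.

On the other hand `A_0` has exponential generating function `e^x f(-x) = exp(-x^p / p)`, which by
its differential equation makes `A_0(N)` Morita's `Γ_p(N)` when `p ∣ N`, so the same ratio is
`∏ (1 + N / j)` over the `j < N` prime to `p`. Pairing `j` with `N - j` in its square yields
`1 - 2 N² S(N) + O(N⁴)` with `S(N) = ∑ j⁻²`. Comparing the terms in `N²` gives
`S(N) → g_1² - 2 g_2`; as `S(2N) - 2 S(N) → 0`, this limit vanishes, and then the terms in `N³` give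
`S(N) / N → 6 Δ_3`. Along `N = p^k` these quotients are the Volkenborn sums whose limit is
`2 L_p(3, ω⁻²)`.
-/

namespace DworkGamma

/-! ### Binomial transforms and tail sums -/

section BinomialTransform

variable {R : Type*} [CommRing R]

/-- The alternating binomial transform `N ↦ ∑ (-1)^n binom(N, n) u(n)`: the value at `N` of the
Mahler series with coefficients `(-1)^n u(n)`. -/
def binomialTransform (u : ℕ → R) (N : ℕ) : R :=
  ∑ n ∈ Finset.range (N + 1), (-1) ^ n * (N.choose n : R) * u n

theorem binomialTransform_zero (u : ℕ → R) : binomialTransform u 0 = u 0 := by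
  simp [binomialTransform]

theorem binomialTransform_succ (u : ℕ → R) (N : ℕ) :
    binomialTransform u (N + 1) = binomialTransform (fun n => u n - u (n + 1)) N := by
  have pascal := Finset.sum_choose_succ_mul (fun n _ => (-1) ^ n * u n) N
  simp only [binomialTransform, ← mul_assoc, ← Nat.cast_comm, mul_sub, Finset.sum_sub_distrib,
    pow_succ, mul_neg, mul_one, neg_mul, Finset.sum_neg_distrib] at pascal ⊢
  rw [pascal, sub_eq_add_neg]

theorem binomialTransform_eq_sub_mul {u t : ℕ → R}
    (h : ∀ n : ℕ, ((n : R) + 1) * (t n - t (n + 1)) = u (n + 1)) (N : ℕ) :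
    binomialTransform u N = u 0 - N * binomialTransform t N := by
  cases N with
  | zero => simp [binomialTransform_zero]
  | succ M =>
    rw [binomialTransform_succ t, binomialTransform, Finset.sum_range_succ', binomialTransform,
      Finset.mul_sum, sub_eq_neg_add, ← Finset.sum_neg_distrib]
    congr 1
    · refine Finset.sum_congr rfl fun n _ => ?_
      have absorption : ((M + 1 : ℕ) : R) * (M.choose n : R) =
          ((M + 1).choose (n + 1) : R) * ((n : R) + 1) := by
        exact_mod_cast congrArg (Nat.cast (R := R)) (Nat.add_one_mul_choose_eq M n)
      rw [← h n, pow_succ]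
      linear_combination (-1) ^ n * (t n - t (n + 1)) * absorption
    · simp

end BinomialTransform

theorem norm_binomialTransform_le {R : Type*} [NormedCommRing R] [NormOneClass R]
    [IsUltrametricDist R] {u : ℕ → R} {C : ℝ} (h : ∀ n, ‖u n‖ ≤ C) (N : ℕ) :
    ‖binomialTransform u N‖ ≤ C := by
  have hC : 0 ≤ C := (norm_nonneg _).trans (h 0)
  refine IsUltrametricDist.norm_sum_le_of_forall_le_of_nonneg hC fun n _ => ?_
  have hcoeff : ‖(-1) ^ n * (N.choose n : R)‖ ≤ 1 := by
    simpa using IsUltrametricDist.norm_intCast_le_one R ((-1) ^ n * (N.choose n : ℤ))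
  calc ‖(-1) ^ n * (N.choose n : R) * u n‖
      ≤ ‖(-1) ^ n * (N.choose n : R)‖ * ‖u n‖ := norm_mul_le _ _
    _ ≤ 1 * C := mul_le_mul hcoeff (h n) (norm_nonneg _) zero_le_one
    _ = C := one_mul C

/-- Sequences decreasing faster than every power of the index. -/
def RapidDecay {E : Type*} [Norm E] (b : ℕ → E) : Prop :=
  ∀ k : ℕ, ∃ C : ℝ, ∀ n : ℕ, (n : ℝ) ^ k * ‖b n‖ ≤ C

theorem RapidDecay.exists_norm_le {E : Type*} [Norm E] {b : ℕ → E} (hb : RapidDecay b) :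
    ∃ C : ℝ, ∀ n, ‖b n‖ ≤ C := by
  simpa using hb 0

theorem rapidDecay_of_norm_le_pow_div {E : Type*} [Norm E] {b : ℕ → E} {r : ℝ} (hr0 : 0 < r)
    (hr1 : r < 1) {d : ℕ} (hd : 0 < d) (h : ∀ n, ‖b n‖ ≤ r ^ (n / d)) : RapidDecay b := by
  intro k
  obtain ⟨C, hC⟩ := ((tendsto_pow_const_mul_const_pow_of_abs_lt_one k
    ((abs_of_pos hr0).trans_lt hr1)).bddAbove_range)
  refine ⟨(d : ℝ) ^ k * (C / r), fun n => ?_⟩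
  have hn : (n : ℝ) ≤ d * (n / d + 1 : ℕ) := by exact_mod_cast (Nat.lt_mul_div_succ n hd).le
  calc (n : ℝ) ^ k * ‖b n‖ ≤ (d * (n / d + 1 : ℕ)) ^ k * r ^ (n / d) :=
        mul_le_mul_of_nonneg (by gcongr) (h n) (by positivity) (by positivity)
    _ = (d : ℝ) ^ k * (((n / d + 1 : ℕ) : ℝ) ^ k * r ^ (n / d + 1) / r) := by
        rw [mul_pow, pow_succ r]
        field_simp
    _ ≤ (d : ℝ) ^ k * (C / r) := by
        gcongr
        exact hC ⟨n / d + 1, rfl⟩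

/-- The tail sums `∑_{m > n} b(m) / m`. On the sequence `n! a_n` attached to a Laurent series
`∑ a_n x^n`, this is the action of `D_x`. -/
noncomputable def tailSum {K : Type*} [Field K] [TopologicalSpace K] (b : ℕ → K) (n : ℕ) : K :=
  ∑' i : ℕ, b (n + i + 1) / ((n + i + 1 : ℕ) : K)

variable {p : ℕ} [Fact p.Prime]

theorem inv_le_norm_natCast {m : ℕ} (hm : m ≠ 0) : (m : ℝ)⁻¹ ≤ ‖(m : ℚ_[p])‖ := by
  rw [Padic.norm_eq_zpow_neg_valuation (by exact_mod_cast hm), zpow_neg, Padic.valuation_natCast,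
    zpow_natCast]
  have hpos : 0 < p ^ padicValNat p m := pow_pos (Fact.out : p.Prime).pos _
  refine inv_anti₀ (by exact_mod_cast hpos) ?_
  exact_mod_cast Nat.le_of_dvd (Nat.pos_of_ne_zero hm) pow_padicValNat_dvd

theorem norm_div_natCast_le (x : ℚ_[p]) {m : ℕ} (hm : m ≠ 0) : ‖x / (m : ℚ_[p])‖ ≤ m * ‖x‖ := by
  have hm0 : (0 : ℝ) < m := by exact_mod_cast Nat.pos_of_ne_zero hm
  rw [norm_div, div_eq_inv_mul]
  gcongr
  exact inv_le_of_inv_le₀ hm0 (inv_le_norm_natCast hm)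

section RapidDecay

variable {b : ℕ → ℚ_[p]}

theorem RapidDecay.summable_div (hb : RapidDecay b) (n : ℕ) :
    Summable fun i : ℕ => b (n + i + 1) / ((n + i + 1 : ℕ) : ℚ_[p]) := by
  obtain ⟨C, hC⟩ := hb 3
  have hsq : Summable fun i : ℕ => C / ((n + i + 1 : ℕ) : ℝ) ^ 2 := by
    have := (summable_nat_add_iff (n + 1)).2 (Real.summable_nat_pow_inv.2 one_lt_two)
    refine (this.mul_left C).congr fun i => ?_
    rw [div_eq_mul_inv, show i + (n + 1) = n + i + 1 by ring]
  refine hsq.of_norm_bounded fun i => (norm_div_natCast_le _ (by omega)).trans ?_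
  rw [le_div_iff₀ (by positivity)]
  linarith [hC (n + i + 1), pow_succ' ((n + i + 1 : ℕ) : ℝ) 2]

protected theorem RapidDecay.tailSum (hb : RapidDecay b) : RapidDecay (tailSum b) := by
  intro k
  obtain ⟨C, hC⟩ := hb (k + 1)
  have hC0 : 0 ≤ C := le_trans (by positivity) (hC 0)
  refine ⟨C, fun n => ?_⟩
  rcases (pow_nonneg (Nat.cast_nonneg (α := ℝ) n) k).eq_or_lt with hnk | hnk
  · simpa [← hnk] using hC0
  rw [mul_comm, ← le_div_iff₀ hnk]
  refine IsUltrametricDist.norm_tsum_le_of_forall_le_of_nonneg (by positivity) fun i => ?_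
  rw [le_div_iff₀ hnk]
  calc ‖b (n + i + 1) / ((n + i + 1 : ℕ) : ℚ_[p])‖ * (n : ℝ) ^ k
      ≤ ((n + i + 1 : ℕ) : ℝ) * ‖b (n + i + 1)‖ * ((n + i + 1 : ℕ) : ℝ) ^ k := by
        gcongr
        · exact norm_div_natCast_le _ (by omega)
        · omega
    _ = ((n + i + 1 : ℕ) : ℝ) ^ (k + 1) * ‖b (n + i + 1)‖ := by ring
    _ ≤ C := hC _

protected theorem RapidDecay.iterate_tailSum (hb : RapidDecay b) (s : ℕ) :
    RapidDecay (tailSum^[s] b) :=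
  Function.Iterate.rec RapidDecay hb (fun _ => RapidDecay.tailSum) s

theorem RapidDecay.natCast_add_one_mul_tailSum_sub (hb : RapidDecay b) (n : ℕ) :
    ((n : ℚ_[p]) + 1) * (tailSum b n - tailSum b (n + 1)) = b (n + 1) := by
  have hn : (n : ℚ_[p]) + 1 ≠ 0 := Nat.cast_add_one_ne_zero n
  have hsplit : tailSum b n = b (n + 1) / ((n : ℚ_[p]) + 1) + tailSum b (n + 1) := by
    rw [tailSum, (hb.summable_div n).tsum_eq_zero_add, tailSum]
    simp only [add_zero, Nat.cast_add, Nat.cast_one, ← add_assoc, add_right_comm]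
  rw [hsplit, add_sub_cancel_right, mul_div_cancel₀ _ hn]

theorem RapidDecay.binomialTransform_eq (hb : RapidDecay b) (N : ℕ) :
    binomialTransform b N = b 0 - N * binomialTransform (tailSum b) N :=
  binomialTransform_eq_sub_mul hb.natCast_add_one_mul_tailSum_sub N

end RapidDecay

/-! ### Naturals tending `p`-adically to zero -/

/-- The filter on `ℕ` of nonzero naturals tending `p`-adically to `0`. -/
noncomputable def padicZeroFilter (p : ℕ) [Fact p.Prime] : Filter ℕ :=
  comap (Nat.cast : ℕ → ℚ_[p]) (𝓝[≠] 0)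

theorem tendsto_natCast_padicZeroFilter :
    Tendsto (Nat.cast : ℕ → ℚ_[p]) (padicZeroFilter p) (𝓝[≠] 0) :=
  tendsto_comap

theorem tendsto_natCast_nhds_zero :
    Tendsto (Nat.cast : ℕ → ℚ_[p]) (padicZeroFilter p) (𝓝 0) :=
  tendsto_natCast_padicZeroFilter.mono_right nhdsWithin_le_nhds

theorem eventually_natCast_ne_zero : ∀ᶠ N : ℕ in padicZeroFilter p, (N : ℚ_[p]) ≠ 0 :=
  tendsto_natCast_padicZeroFilter.eventually self_mem_nhdsWithin

theorem eventually_dvd : ∀ᶠ N in padicZeroFilter p, p ∣ N := by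
  filter_upwards [tendsto_natCast_nhds_zero.norm.eventually_lt_const (by simp : ‖(0 : ℚ_[p])‖ < 1)]
    with N hN using (Padic.norm_natCast_lt_one_iff).1 hN

theorem tendsto_padicZeroFilter_iff {α : Type*} {l : Filter α} {N : α → ℕ} :
    Tendsto N l (padicZeroFilter p) ↔ Tendsto (fun k => (N k : ℚ_[p])) l (𝓝[≠] 0) :=
  tendsto_comap_iff

theorem tendsto_two_mul_padicZeroFilter :
    Tendsto (2 * ·) (padicZeroFilter p) (padicZeroFilter p) := by
  refine tendsto_padicZeroFilter_iff.2 (tendsto_nhdsWithin_iff.2 ⟨?_, ?_⟩)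
  · simpa using tendsto_natCast_nhds_zero.const_mul (2 : ℚ_[p])
  · filter_upwards [eventually_natCast_ne_zero] with N hN
    simpa using hN

theorem tendsto_prime_pow_padicZeroFilter :
    Tendsto (fun k => p ^ (k + 1)) atTop (padicZeroFilter p) := by
  refine tendsto_padicZeroFilter_iff.2 (tendsto_nhdsWithin_iff.2 ⟨?_, Eventually.of_forall ?_⟩)
  · simpa [Function.comp_def] using (tendsto_pow_atTop_nhds_zero_of_norm_lt_one
      (Padic.norm_p_lt_one (p := p))).comp (tendsto_add_atTop_nat 1)
  · simp [(Fact.out : p.Prime).ne_zero]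

instance padicZeroFilter_neBot : (padicZeroFilter p).NeBot :=
  tendsto_prime_pow_padicZeroFilter.neBot

theorem RapidDecay.tendsto_binomialTransform {b : ℕ → ℚ_[p]} (hb : RapidDecay b) :
    Tendsto (binomialTransform b) (padicZeroFilter p) (𝓝 (b 0)) := by
  obtain ⟨C, hC⟩ := hb.tailSum.exists_norm_le
  have hmul : Tendsto (fun N : ℕ => (N : ℚ_[p]) * binomialTransform (tailSum b) N)
      (padicZeroFilter p) (𝓝 0) := by
    refine tendsto_natCast_nhds_zero.zero_mul_isBoundedUnder_le ?_
    exact isBoundedUnder_of ⟨C, norm_binomialTransform_le hC⟩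
  simpa only [← hb.binomialTransform_eq, sub_zero] using hmul.const_sub (b 0)

/-! ### The duplication ratio -/

/-- The ratio `u(2N) / u(N)²`, measuring how far `u` is from being exponential at `N`. -/
def duplicationRatio {K : Type*} [Field K] (u : ℕ → K) (N : ℕ) : K :=
  u (2 * N) / u N ^ 2

theorem tendsto_sq_sub_one_div {α K : Type*} [Field K] [NeZero (2 : K)] [TopologicalSpace K]
    [IsTopologicalRing K] {l : Filter α} {u t : α → K} {c : K} (hu : Tendsto u l (𝓝 1))
    (h : Tendsto (fun x => (u x - 1) / t x) l (𝓝 c)) :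
    Tendsto (fun x => (u x ^ 2 - 1) / (2 * t x)) l (𝓝 c) := by
  have hmean : Tendsto (fun x => (u x + 1) / 2) l (𝓝 1) := by
    simpa [one_add_one_eq_two, div_self (two_ne_zero (α := K))] using (hu.add_const 1).div_const 2
  have hlim := hmean.mul h
  rw [one_mul] at hlim
  refine hlim.congr fun x => ?_
  rw [div_mul_div_comm]
  ring

section DuplicationRatio

variable {b : ℕ → ℚ_[p]} (hb : RapidDecay b) (hb0 : b 0 = 1)

include hb hb0

theorem RapidDecay.binomialTransform_two_mul_sub_sq (N : ℕ) :
    binomialTransform b (2 * N) - binomialTransform b N ^ 2 =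
      (N : ℚ_[p]) ^ 2 * (4 * binomialTransform (tailSum^[2] b) (2 * N) -
        2 * binomialTransform (tailSum^[2] b) N - binomialTransform (tailSum b) N ^ 2) := by
  have expansion (M : ℕ) : binomialTransform b M =
      1 - M * (tailSum b 0 - M * binomialTransform (tailSum^[2] b) M) := by
    rw [hb.binomialTransform_eq, hb.tailSum.binomialTransform_eq, hb0]
    rfl
  have hTail : binomialTransform (tailSum b) N =
      tailSum b 0 - N * binomialTransform (tailSum^[2] b) N := hb.tailSum.binomialTransform_eq N
  rw [expansion, expansion, hTail]
  push_cast
  ring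

theorem RapidDecay.eventually_duplicationRatio_sub_one :
    ∀ᶠ N in padicZeroFilter p, duplicationRatio (binomialTransform b) N - 1 =
      (N : ℚ_[p]) ^ 2 * ((4 * binomialTransform (tailSum^[2] b) (2 * N) -
        2 * binomialTransform (tailSum^[2] b) N - binomialTransform (tailSum b) N ^ 2) /
        binomialTransform b N ^ 2) := by
  filter_upwards [hb.tendsto_binomialTransform.eventually_ne (hb0.trans_ne one_ne_zero)] with N hN
  rw [duplicationRatio, div_sub_one (pow_ne_zero 2 hN), hb.binomialTransform_two_mul_sub_sq hb0,
    mul_div_assoc]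

theorem RapidDecay.tendsto_duplicationRatio :
    Tendsto (duplicationRatio (binomialTransform b)) (padicZeroFilter p) (𝓝 1) := by
  have hB := hb.tendsto_binomialTransform
  rw [hb0] at hB
  exact ((hB.comp tendsto_two_mul_padicZeroFilter).div (hB.pow 2) (by simp)).trans_eq (by simp)

theorem RapidDecay.tendsto_duplicationRatio_sub_one_div_sq :
    Tendsto (fun N : ℕ => (duplicationRatio (binomialTransform b) N - 1) / (N : ℚ_[p]) ^ 2)
      (padicZeroFilter p) (𝓝 (2 * (tailSum^[2] b) 0 - (tailSum b) 0 ^ 2)) := by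
  have hB := hb.tendsto_binomialTransform
  have hB₁ := hb.tailSum.tendsto_binomialTransform
  have hB₂ := (hb.iterate_tailSum 2).tendsto_binomialTransform
  rw [hb0] at hB
  have hlim := ((((hB₂.comp tendsto_two_mul_padicZeroFilter).const_mul 4).sub
    (hB₂.const_mul 2)).sub (hB₁.pow 2)).div (hB.pow 2) (by simp)
  refine (hlim.congr' ?_).trans_eq (by congr 1; ring)
  filter_upwards [hb.eventually_duplicationRatio_sub_one hb0, eventually_natCast_ne_zero]
    with N hN hN0
  rw [hN, mul_div_cancel_left₀ _ (pow_ne_zero 2 hN0)]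
  rfl

theorem RapidDecay.tendsto_duplicationRatio_sub_one_div_cube
    (h : 2 * (tailSum^[2] b) 0 = (tailSum b) 0 ^ 2) :
    Tendsto (fun N : ℕ => (duplicationRatio (binomialTransform b) N - 1) / (N : ℚ_[p]) ^ 3)
      (padicZeroFilter p) (𝓝 ((tailSum b) 0 ^ 3 - 6 * (tailSum^[3] b) 0)) := by
  have hB := hb.tendsto_binomialTransform
  have hB₂ := (hb.iterate_tailSum 2).tendsto_binomialTransform
  have hB₃ := (hb.iterate_tailSum 3).tendsto_binomialTransform
  have hnum (N : ℕ) : 4 * binomialTransform (tailSum^[2] b) (2 * N) -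
      2 * binomialTransform (tailSum^[2] b) N - binomialTransform (tailSum b) N ^ 2 =
      (2 * binomialTransform (tailSum^[3] b) N - 8 * binomialTransform (tailSum^[3] b) (2 * N) +
        2 * tailSum b 0 * binomialTransform (tailSum^[2] b) N -
        N * binomialTransform (tailSum^[2] b) N ^ 2) * N := by
    have hB₁_eq : binomialTransform (tailSum b) N =
        tailSum b 0 - N * binomialTransform (tailSum^[2] b) N := hb.tailSum.binomialTransform_eq N
    have hB₂_eq (M : ℕ) : binomialTransform (tailSum^[2] b) M =
        (tailSum^[2] b) 0 - M * binomialTransform (tailSum^[3] b) M :=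
      (hb.iterate_tailSum 2).binomialTransform_eq M
    have hB₂_two_mul := hB₂_eq (2 * N)
    push_cast at hB₂_two_mul
    rw [hB₁_eq]
    linear_combination 4 * hB₂_two_mul - 2 * hB₂_eq N + h
  rw [hb0] at hB
  have hlim := ((((hB₃.const_mul 2).sub
    ((hB₃.comp tendsto_two_mul_padicZeroFilter).const_mul 8)).add
    (hB₂.const_mul (2 * tailSum b 0))).sub
    (tendsto_natCast_nhds_zero.mul (hB₂.pow 2))).div (hB.pow 2) (by simp)
  refine (hlim.congr' ?_).trans_eq (by congr 1; linear_combination tailSum b 0 * h)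
  filter_upwards [hb.eventually_duplicationRatio_sub_one hb0, eventually_natCast_ne_zero]
    with N hN hN0
  rw [hN, hnum, pow_succ _ 2, mul_div_mul_left _ _ (pow_ne_zero 2 hN0), div_right_comm,
    mul_div_cancel_right₀ _ hN0]
  rfl

end DuplicationRatio

/-! ### The operator `D_x` on coefficients -/

theorem iterate_pderiv_apply (i : ℕ) (a : Laurent p) (n : ℤ) :
    (pderiv^[i] a) n = (∏ j ∈ Finset.range i, ((n + 1 + j : ℤ) : ℚ_[p])) * a (n + i) := by
  induction i generalizing n with
  | zero => simp
  | succ i ih =>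
    rw [Function.iterate_succ_apply', pderiv, ih, Finset.prod_range_succ', ← mul_assoc]
    push_cast
    simp only [add_comm, add_left_comm, mul_comm, zero_add]

theorem summable_iterate_pderiv_of_neg (a : Laurent p) {n : ℤ} (hn : n < 0) :
    Summable fun i : ℕ => (pderiv^[i] a) n := by
  obtain ⟨m, rfl⟩ := Int.exists_eq_neg_ofNat hn.le
  refine summable_of_ne_finset_zero (s := Finset.range m) fun i hi => ?_
  have hmem : m - 1 ∈ Finset.range i := by
    rw [Finset.mem_range] at hi ⊢
    omega
  rw [iterate_pderiv_apply, Finset.prod_eq_zero hmem, zero_mul]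
  rw [Int.cast_eq_zero]
  omega

theorem factorial_mul_iterate_pderiv (a : Laurent p) (n i : ℕ) :
    (n.factorial : ℚ_[p]) * (pderiv^[i] (divX a)) n =
      ((n + i + 1).factorial : ℚ_[p]) * a ((n + i + 1 : ℕ) : ℤ) / ((n + i + 1 : ℕ) : ℚ_[p]) := by
  have hprod : (n.factorial : ℚ_[p]) * ∏ j ∈ Finset.range i, (((n : ℤ) + 1 + j : ℤ) : ℚ_[p]) =
      ((n + i).factorial : ℚ_[p]) := by
    rw [← Nat.factorial_mul_ascFactorial, Nat.ascFactorial_eq_prod_range]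
    push_cast
    rfl
  have hne : ((n + i + 1 : ℕ) : ℚ_[p]) ≠ 0 := Nat.cast_ne_zero.2 (Nat.succ_ne_zero _)
  rw [iterate_pderiv_apply, ← mul_assoc, hprod, Nat.factorial_succ, Nat.cast_mul, mul_assoc,
    mul_div_cancel_left₀ _ hne, divX]
  push_cast
  rfl

/-- The coefficients `n! a_n`, `n ≥ 0`, of the formal Laplace transform of a Laurent series
`∑ a_n x^n`; on these `D_x` acts by tail sums. -/
noncomputable def laplaceCoeff (a : Laurent p) (n : ℕ) : ℚ_[p] :=
  (n.factorial : ℚ_[p]) * a n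

theorem RapidDecay.summable_iterate_pderiv {a : Laurent p} (ha : RapidDecay (laplaceCoeff a))
    (n : ℤ) :
    Summable fun i : ℕ => (pderiv^[i] (divX a)) n := by
  rcases lt_or_ge n 0 with hn | hn
  · exact summable_iterate_pderiv_of_neg _ hn
  · lift n to ℕ using hn
    have hfact : (n.factorial : ℚ_[p]) ≠ 0 := Nat.cast_ne_zero.2 n.factorial_ne_zero
    rw [← summable_mul_left_iff hfact]
    simp only [factorial_mul_iterate_pderiv]
    exact ha.summable_div n

theorem laplaceCoeff_Dx (a : Laurent p) : laplaceCoeff (Dx a) = tailSum (laplaceCoeff a) := by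
  funext n
  rw [laplaceCoeff, Dx, derivSum, ← tsum_mul_left]
  simp only [factorial_mul_iterate_pderiv, tailSum, laplaceCoeff]

theorem laplaceCoeff_iterate_Dx (a : Laurent p) (s : ℕ) :
    laplaceCoeff (Dx^[s] a) = tailSum^[s] (laplaceCoeff a) :=
  Function.Semiconj.iterate_right laplaceCoeff_Dx s a

/-! ### Exponential generating functions -/

section ExponentialGeneratingFunction

open PowerSeries

variable {K : Type*} [CommRing K]

/-- The coefficients of `f` as an exponential generating function. -/
noncomputable def egfCoeff (f : K⟦X⟧) (n : ℕ) : K :=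
  n.factorial * coeff n f

theorem egfCoeff_zero (f : K⟦X⟧) : egfCoeff f 0 = constantCoeff f := by
  simp [egfCoeff]

theorem egfCoeff_succ_of_derivative_eq {f : K⟦X⟧} {a c : K} {m : ℕ}
    (h : derivative K f = (C a + C c * X ^ m) * f) (n : ℕ) :
    egfCoeff f (n + 1) = a * egfCoeff f n + c * (n.descFactorial m * egfCoeff f (n - m)) := by
  have hcoeff := congrArg (coeff n) h
  rw [coeff_derivative, add_mul, map_add, coeff_C_mul, mul_assoc, coeff_C_mul,
    coeff_X_pow_mul'] at hcoeff
  have hdesc : (n.factorial : K) * (if m ≤ n then coeff (n - m) f else 0) =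
      n.descFactorial m * egfCoeff f (n - m) := by
    split_ifs with hm
    · rw [egfCoeff, ← Nat.factorial_mul_descFactorial hm]
      push_cast
      ring
    · simp [Nat.descFactorial_eq_zero_iff_lt.2 (not_le.1 hm)]
  rw [← hdesc, egfCoeff, egfCoeff, Nat.factorial_succ]
  push_cast
  linear_combination (n.factorial : K) * hcoeff

theorem derivative_rescale (a : K) (f : K⟦X⟧) :
    derivative K (rescale a f) = C a * rescale a (derivative K f) := by
  ext n
  simp only [coeff_derivative, coeff_rescale, coeff_C_mul]
  ring

theorem egfCoeff_exp_mul_rescale_neg_one [Algebra ℚ K] (f : K⟦X⟧) :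
    egfCoeff (exp K * rescale (-1) f) = binomialTransform (egfCoeff f) := by
  funext N
  rw [egfCoeff, mul_comm (exp K), coeff_mul, Finset.Nat.sum_antidiagonal_eq_sum_range_succ_mk,
    binomialTransform, Finset.mul_sum]
  refine Finset.sum_congr rfl fun n hn => ?_
  have hcancel : ((N - n).factorial : K) * algebraMap ℚ K (1 / (N - n).factorial) = 1 := by
    rw [← map_natCast (algebraMap ℚ K), ← map_mul,
      mul_one_div_cancel (Nat.cast_ne_zero.2 (Nat.factorial_ne_zero _)), map_one]
  rw [coeff_rescale, coeff_exp, egfCoeff,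
    ← Nat.choose_mul_factorial_mul_factorial (Finset.mem_range_succ_iff.1 hn)]
  push_cast
  linear_combination (N.choose n : K) * n.factorial * ((-1) ^ n * coeff n f) * hcancel

end ExponentialGeneratingFunction

theorem laplaceCoeff_ofPowerSeries (f : PowerSeries ℚ_[p]) :
    laplaceCoeff (ofPowerSeries f) = egfCoeff f := by
  funext n
  simp [laplaceCoeff, ofPowerSeries, egfCoeff]

/-! ### The Dwork exponential -/

section DworkExp

open PowerSeries

theorem hasSubst_dworkExp : HasSubst (X + C ((p : ℚ_[p])⁻¹) * X ^ p : ℚ_[p]⟦X⟧) :=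
  HasSubst.of_constantCoeff_zero' (by simp [(Fact.out : p.Prime).ne_zero])

theorem constantCoeff_dworkExp : constantCoeff (dworkExp p) = 1 := by
  rw [← coeff_zero_eq_constantCoeff_apply, dworkExp, coeff_subst' hasSubst_dworkExp,
    finsum_eq_single _ 0 fun n hn => by simp [(Fact.out : p.Prime).ne_zero, hn]]
  simp

theorem derivative_dworkExp : derivative ℚ_[p] (dworkExp p) = (1 + X ^ (p - 1)) * dworkExp p := by
  have hp : (p : ℚ_[p]) ≠ 0 := Nat.cast_ne_zero.2 (Fact.out : p.Prime).ne_zero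
  have hexponent : derivative ℚ_[p] (X + C ((p : ℚ_[p])⁻¹) * X ^ p) = 1 + X ^ (p - 1) := by
    rw [map_add, derivative_X, Derivation.leibniz, derivative_C, derivative_pow, derivative_X,
      ← map_natCast (C (R := ℚ_[p]))]
    simp only [smul_eq_mul, mul_zero, add_zero, mul_one]
    rw [← mul_assoc, ← map_mul, inv_mul_cancel₀ hp, map_one, one_mul]
  rw [dworkExp, derivative_subst hasSubst_dworkExp, derivative_exp, hexponent, mul_comm]

theorem derivative_exp_mul_rescale_dworkExp (hp2 : p ≠ 2) :
    derivative ℚ_[p] (exp ℚ_[p] * rescale (-1) (dworkExp p)) =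
      -X ^ (p - 1) * (exp ℚ_[p] * rescale (-1) (dworkExp p)) := by
  have heven : Even (p - 1) := (Fact.out : p.Prime).even_sub_one hp2
  rw [Derivation.leibniz, derivative_exp, derivative_rescale, derivative_dworkExp,
    map_mul, map_add, map_one, map_pow, rescale_X, map_neg, map_one, mul_pow, heven.neg_one_pow]
  simp only [smul_eq_mul]
  ring

/-- The coefficients `n! [x^n] f` of the Dwork exponential. -/
noncomputable def dworkSeq (p : ℕ) [Fact p.Prime] : ℕ → ℚ_[p] :=
  egfCoeff (dworkExp p)

theorem dworkSeq_zero : dworkSeq p 0 = 1 := by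
  rw [dworkSeq, egfCoeff_zero, constantCoeff_dworkExp]

theorem dworkSeq_succ (n : ℕ) : dworkSeq p (n + 1) =
    dworkSeq p n + n.descFactorial (p - 1) * dworkSeq p (n - (p - 1)) := by
  simpa [dworkSeq] using egfCoeff_succ_of_derivative_eq (f := dworkExp p) (a := 1) (c := 1)
    (by simpa using derivative_dworkExp) n

theorem binomialTransform_dworkSeq_succ (hp2 : p ≠ 2) (n : ℕ) :
    binomialTransform (dworkSeq p) (n + 1) =
      -(n.descFactorial (p - 1) * binomialTransform (dworkSeq p) (n - (p - 1))) := by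
  have hderiv := derivative_exp_mul_rescale_dworkExp hp2
  rw [show (-X ^ (p - 1) : ℚ_[p]⟦X⟧) = C 0 + C (-1) * X ^ (p - 1) by simp] at hderiv
  simpa [dworkSeq, egfCoeff_exp_mul_rescale_neg_one] using egfCoeff_succ_of_derivative_eq hderiv n

end DworkExp

theorem laplaceCoeff_DxPowDwork (s : ℕ) :
    laplaceCoeff (DxPowDwork p s) = tailSum^[s] (dworkSeq p) := by
  rw [DxPowDwork, laplaceCoeff_iterate_Dx, laplaceCoeff_ofPowerSeries, dworkSeq]

theorem constTerm_DxPowDwork (s : ℕ) :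
    constTerm (DxPowDwork p s) = (tailSum^[s] (dworkSeq p)) 0 := by
  simp [← laplaceCoeff_DxPowDwork, laplaceCoeff, constTerm]

theorem norm_natCast_le_inv_of_dvd {m : ℕ} (h : p ∣ m) : ‖(m : ℚ_[p])‖ ≤ (p : ℝ)⁻¹ := by
  simpa using (Padic.norm_int_le_pow_iff_dvd (p := p) (m : ℤ) 1).2 (by simpa using mod_cast h)

theorem norm_dworkSeq_le_one (n : ℕ) : ‖dworkSeq p n‖ ≤ 1 := by
  induction n using Nat.strong_induction_on with
  | _ n ih =>
    cases n with
    | zero => simp [dworkSeq_zero]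
    | succ n =>
      rw [dworkSeq_succ]
      refine (IsUltrametricDist.norm_add_le_max _ _).trans (max_le (ih n (by omega)) ?_)
      rw [norm_mul]
      exact mul_le_one₀ (IsUltrametricDist.norm_natCast_le_one _ _) (norm_nonneg _)
        (ih _ (by omega))

theorem dvd_descFactorial_sub_one {n : ℕ} (h : ¬ p ∣ n + 1) : p ∣ n.descFactorial (p - 1) := by
  have hp : p.Prime := Fact.out
  have hdvd : p ∣ (n + 1).descFactorial (p - 1 + 1) := by
    rw [Nat.sub_add_cancel hp.one_le]
    exact (Nat.dvd_factorial hp.pos le_rfl).trans (Nat.factorial_dvd_descFactorial _ _)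
  rw [Nat.succ_descFactorial_succ] at hdvd
  exact (hp.dvd_mul.1 hdvd).resolve_left h

theorem dvd_descFactorial_sub_one_add_one (j : ℕ) :
    p ∣ (p * j + (p - 1)).descFactorial (p - 1) + 1 := by
  have wilson := ZMod.wilsons_lemma p
  rw [← Nat.one_ascFactorial, Nat.ascFactorial_eq_prod_range] at wilson
  rw [← CharP.cast_eq_zero_iff (ZMod p) p, Nat.add_descFactorial_eq_ascFactorial,
    Nat.ascFactorial_eq_prod_range]
  push_cast at wilson ⊢
  simp only [CharP.cast_eq_zero, zero_mul, zero_add, wilson, neg_add_cancel]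

theorem norm_dworkSeq_succ_sub_le {n : ℕ} (h : ¬ p ∣ n + 1) :
    ‖dworkSeq p (n + 1) - dworkSeq p n‖ ≤ (p : ℝ)⁻¹ * ‖dworkSeq p (n - (p - 1))‖ := by
  rw [dworkSeq_succ, add_sub_cancel_left, norm_mul]
  gcongr
  exact norm_natCast_le_inv_of_dvd (dvd_descFactorial_sub_one h)

section Contraction

variable {M : ℕ} {ε : ℝ} (h : ∀ n, M ≤ n → ‖dworkSeq p n‖ ≤ ε)

include h

theorem norm_dworkSeq_mul_add_sub_le {j : ℕ} (hj : M + p ≤ p * j) {i : ℕ} (hi : i < p) :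
    ‖dworkSeq p (p * j + i) - dworkSeq p (p * j)‖ ≤ (p : ℝ)⁻¹ * ε := by
  induction i with
  | zero =>
    have hε : 0 ≤ ε := (norm_nonneg _).trans (h M le_rfl)
    simpa using by positivity
  | succ i ih =>
    have hdvd : ¬ p ∣ p * j + i + 1 := by
      rw [add_assoc, Nat.dvd_add_right (dvd_mul_right p j)]
      exact Nat.not_dvd_of_pos_of_lt (by omega) hi
    rw [← add_assoc, ← sub_add_sub_cancel]
    refine (IsUltrametricDist.norm_add_le_max _ _).trans (max_le ?_ (ih (by omega)))
    refine (norm_dworkSeq_succ_sub_le hdvd).trans ?_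
    gcongr
    exact h _ (by omega)

theorem norm_dworkSeq_mul_succ_le {j : ℕ} (hj : M + p ≤ p * j) :
    ‖dworkSeq p (p * (j + 1))‖ ≤ (p : ℝ)⁻¹ * ε := by
  have hpos := (Fact.out : p.Prime).pos
  have hsplit : dworkSeq p (p * (j + 1)) =
      (dworkSeq p (p * j + (p - 1)) - dworkSeq p (p * j)) +
        ((p * j + (p - 1)).descFactorial (p - 1) + 1 : ℕ) * dworkSeq p (p * j) := by
    rw [show p * (j + 1) = p * j + (p - 1) + 1 by rw [mul_add]; omega, dworkSeq_succ,
      Nat.add_sub_cancel]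
    push_cast
    ring
  rw [hsplit]
  refine (IsUltrametricDist.norm_add_le_max _ _).trans
    (max_le (norm_dworkSeq_mul_add_sub_le h hj (by omega)) ?_)
  rw [norm_mul]
  gcongr
  · exact norm_natCast_le_inv_of_dvd (dvd_descFactorial_sub_one_add_one j)
  · exact h _ (by omega)

theorem norm_dworkSeq_le_inv_mul {n : ℕ} (hn : M + 3 * p ≤ n) :
    ‖dworkSeq p n‖ ≤ (p : ℝ)⁻¹ * ε := by
  have hmod := Nat.mod_lt n (Fact.out : p.Prime).pos
  obtain ⟨j, hj⟩ : ∃ j, n / p = j + 1 := Nat.exists_eq_add_one.2 (Nat.div_pos (by omega) (by omega))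
  have hdiv : n = p * (j + 1) + n % p := hj ▸ (Nat.div_add_mod n p).symm
  have hM : M + p ≤ p * j := by
    rw [mul_add] at hdiv
    omega
  rw [hdiv, ← sub_add_cancel (dworkSeq p (p * (j + 1) + n % p)) (dworkSeq p (p * (j + 1)))]
  refine (IsUltrametricDist.norm_add_le_max _ _).trans
    (max_le (norm_dworkSeq_mul_add_sub_le h ?_ hmod) (norm_dworkSeq_mul_succ_le h hM))
  exact hM.trans (Nat.mul_le_mul_left p j.le_succ)

end Contraction

theorem norm_dworkSeq_le_pow (e : ℕ) {n : ℕ} (hn : 3 * p * e ≤ n) :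
    ‖dworkSeq p n‖ ≤ (p : ℝ)⁻¹ ^ e := by
  induction e generalizing n with
  | zero => simpa using norm_dworkSeq_le_one n
  | succ e ih =>
    rw [pow_succ']
    exact norm_dworkSeq_le_inv_mul (fun _ => ih) hn

theorem rapidDecay_dworkSeq : RapidDecay (dworkSeq p) := by
  have hp : p.Prime := Fact.out
  refine rapidDecay_of_norm_le_pow_div (r := (p : ℝ)⁻¹) (d := 3 * p) ?_ ?_ ?_
    fun n => norm_dworkSeq_le_pow _ (Nat.mul_div_le n (3 * p))
  · exact inv_pos.2 (by exact_mod_cast hp.pos)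
  · exact inv_lt_one_of_one_lt₀ (by exact_mod_cast hp.one_lt)
  · exact Nat.mul_pos three_pos hp.pos

/-! ### Morita's gamma function -/

/-- The positive integers below `N` that are prime to `p`. -/
def unitsBelow (p N : ℕ) : Finset ℕ :=
  {j ∈ Finset.range N | ¬ p ∣ j}

section UnitsBelow

variable {p N j : ℕ}

theorem mem_unitsBelow : j ∈ unitsBelow p N ↔ j < N ∧ ¬ p ∣ j := by
  simp [unitsBelow]

theorem filter_Icc_one_not_dvd (hN : p ∣ N) :
    {n ∈ Finset.Icc 1 N | ¬ p ∣ n} = unitsBelow p N := by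
  ext n
  rw [Finset.mem_filter, Finset.mem_Icc, mem_unitsBelow, and_congr_left_iff]
  intro hn
  have hn0 : n ≠ 0 := fun h => hn (h ▸ dvd_zero p)
  have hnN : n ≠ N := fun h => hn (h ▸ hN)
  omega

theorem sub_mem_unitsBelow (hN : p ∣ N) (hj : j ∈ unitsBelow p N) : N - j ∈ unitsBelow p N := by
  obtain ⟨hlt, hdvd⟩ := mem_unitsBelow.1 hj
  have hj0 : j ≠ 0 := fun h => hdvd (h ▸ dvd_zero p)
  exact mem_unitsBelow.2 ⟨by omega, fun h => hdvd ((Nat.dvd_sub_iff_right hlt.le hN).1 h)⟩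

@[to_additive sum_unitsBelow_natCast_sub]
theorem prod_unitsBelow_natCast_sub {R M : Type*} [AddGroupWithOne R] [CommMonoid M]
    (hN : p ∣ N) (f : R → M) :
    ∏ j ∈ unitsBelow p N, f (N - j) = ∏ j ∈ unitsBelow p N, f j := by
  have hinv {j : ℕ} (hj : j ∈ unitsBelow p N) : N - (N - j) = j :=
    Nat.sub_sub_self (mem_unitsBelow.1 hj).1.le
  refine Finset.prod_nbij' (N - ·) (N - ·) (fun _ => sub_mem_unitsBelow hN)
    (fun _ => sub_mem_unitsBelow hN) (fun _ => hinv) (fun _ => hinv) fun j hj => ?_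
  rw [Nat.cast_sub (mem_unitsBelow.1 hj).1.le]

@[to_additive sum_unitsBelow_two_mul]
theorem prod_unitsBelow_two_mul {M : Type*} [CommMonoid M] (hN : p ∣ N) (f : ℕ → M) :
    ∏ j ∈ unitsBelow p (2 * N), f j =
      (∏ j ∈ unitsBelow p N, f j) * ∏ j ∈ unitsBelow p N, f (N + j) := by
  simp only [unitsBelow, Finset.prod_filter, two_mul, Finset.prod_range_add,
    Nat.dvd_add_right hN]

theorem prod_unitsBelow_mul_succ (hp : p ≠ 0) (k : ℕ) :
    ∏ j ∈ unitsBelow p (p * (k + 1)), j =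
      (∏ j ∈ unitsBelow p (p * k), j) * (p * k + 1).ascFactorial (p - 1) := by
  obtain ⟨q, rfl⟩ := Nat.exists_eq_succ_of_ne_zero hp
  simp only [unitsBelow, Finset.prod_filter, mul_add_one, Finset.prod_range_add]
  congr 1
  rw [Finset.prod_range_succ', if_neg (by simp), mul_one, Nat.succ_sub_one,
    Nat.ascFactorial_eq_prod_range]
  refine Finset.prod_congr rfl fun i hi => ?_
  have hdvd : ¬ q + 1 ∣ (q + 1) * k + (i + 1) := by
    rw [Nat.dvd_add_right (dvd_mul_right _ k)]
    exact Nat.not_dvd_of_pos_of_lt i.succ_pos (Nat.succ_lt_succ (Finset.mem_range.1 hi))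
  rw [if_pos hdvd]
  ring

end UnitsBelow

theorem norm_natCast_eq_one_of_not_dvd {j : ℕ} (h : ¬ p ∣ j) : ‖(j : ℚ_[p])‖ = 1 := by
  rw [Padic.norm_natCast_eq_one_iff]
  exact (Fact.out : p.Prime).coprime_iff_not_dvd.2 h

theorem norm_of_mem_unitsBelow {N j : ℕ} (hj : j ∈ unitsBelow p N) : ‖(j : ℚ_[p])‖ = 1 :=
  norm_natCast_eq_one_of_not_dvd (mem_unitsBelow.1 hj).2

theorem ne_zero_of_mem_unitsBelow {N j : ℕ} (hj : j ∈ unitsBelow p N) : (j : ℚ_[p]) ≠ 0 :=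
  norm_ne_zero_iff.1 (norm_of_mem_unitsBelow hj ▸ one_ne_zero)

theorem norm_sub_of_mem_unitsBelow {N j : ℕ} (hN : p ∣ N) (hj : j ∈ unitsBelow p N) :
    ‖(N : ℚ_[p]) - j‖ = 1 := by
  rw [← Nat.cast_sub (mem_unitsBelow.1 hj).1.le]
  exact norm_of_mem_unitsBelow (sub_mem_unitsBelow hN hj)

theorem sub_ne_zero_of_mem_unitsBelow {N j : ℕ} (hN : p ∣ N) (hj : j ∈ unitsBelow p N) :
    (N : ℚ_[p]) - j ≠ 0 :=
  norm_ne_zero_iff.1 (norm_sub_of_mem_unitsBelow hN hj ▸ one_ne_zero)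

theorem norm_two_eq_one (hp2 : p ≠ 2) : ‖(2 : ℚ_[p])‖ = 1 := by
  exact_mod_cast norm_natCast_eq_one_of_not_dvd (p := p)
    fun h => hp2 ((Nat.prime_dvd_prime_iff_eq Fact.out Nat.prime_two).1 h)

/-- Morita's `p`-adic gamma function at natural numbers, `Γ_p(N) = (-1)^N ∏_{j < N, p ∤ j} j`. -/
noncomputable def moritaGamma (p : ℕ) [Fact p.Prime] (N : ℕ) : ℚ_[p] :=
  (-1) ^ N * ∏ j ∈ unitsBelow p N, (j : ℚ_[p])

theorem binomialTransform_dworkSeq (hp2 : p ≠ 2) {N : ℕ} (hN : p ∣ N) :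
    binomialTransform (dworkSeq p) N = moritaGamma p N := by
  have hp : p.Prime := Fact.out
  obtain ⟨k, rfl⟩ := hN
  induction k with
  | zero => simp [binomialTransform_zero, moritaGamma, unitsBelow, dworkSeq_zero]
  | succ k ih =>
    have hprod := congrArg (Nat.cast (R := ℚ_[p])) (prod_unitsBelow_mul_succ hp.ne_zero k)
    push_cast at hprod
    rw [moritaGamma, hprod, show p * (k + 1) = p * k + (p - 1) + 1 by
      rw [mul_add_one, add_assoc, Nat.sub_add_cancel hp.one_le],
      binomialTransform_dworkSeq_succ hp2, Nat.add_sub_cancel, ih,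
      Nat.add_descFactorial_eq_ascFactorial, moritaGamma, pow_succ, pow_add,
      (hp.even_sub_one hp2).neg_one_pow]
    ring

theorem moritaGamma_two_mul {N : ℕ} (hN : p ∣ N) :
    moritaGamma p (2 * N) = moritaGamma p N ^ 2 * ∏ j ∈ unitsBelow p N, (1 + (N : ℚ_[p]) / j) := by
  have hprod : ∏ j ∈ unitsBelow p N, ((N + j : ℕ) : ℚ_[p]) =
      (∏ j ∈ unitsBelow p N, (j : ℚ_[p])) * ∏ j ∈ unitsBelow p N, (1 + (N : ℚ_[p]) / j) := by
    rw [← Finset.prod_mul_distrib]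
    refine Finset.prod_congr rfl fun j hj => ?_
    rw [mul_one_add, mul_div_cancel₀ _ (ne_zero_of_mem_unitsBelow hj), Nat.cast_add, add_comm]
  rw [moritaGamma, moritaGamma, prod_unitsBelow_two_mul hN, hprod, mul_comm 2 N, pow_mul]
  ring

theorem moritaGamma_ne_zero (N : ℕ) : moritaGamma p N ≠ 0 :=
  mul_ne_zero (pow_ne_zero _ (neg_ne_zero.2 one_ne_zero))
    (Finset.prod_ne_zero_iff.2 fun _ => ne_zero_of_mem_unitsBelow)

theorem duplicationRatio_dworkSeq (hp2 : p ≠ 2) {N : ℕ} (hN : p ∣ N) :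
    duplicationRatio (binomialTransform (dworkSeq p)) N =
      ∏ j ∈ unitsBelow p N, (1 + (N : ℚ_[p]) / j) := by
  rw [duplicationRatio, binomialTransform_dworkSeq hp2 hN,
    binomialTransform_dworkSeq hp2 (hN.mul_left 2), moritaGamma_two_mul hN,
    mul_div_cancel_left₀ _ (pow_ne_zero 2 (moritaGamma_ne_zero N))]

/-! ### Inverse squares and the duplication ratio -/

/-- The sum `∑ j⁻²` over `0 < j < N` prime to `p`. -/
noncomputable def sumInvSq (p : ℕ) [Fact p.Prime] (N : ℕ) : ℚ_[p] :=
  ∑ j ∈ unitsBelow p N, ((j : ℚ_[p]) ^ 2)⁻¹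

theorem norm_prod_one_add_sub_one_sub_sum_le {ι R : Type*} [NormedCommRing R] [NormOneClass R]
    [IsUltrametricDist R] (s : Finset ι) {y : ι → R} {ε : ℝ} (h0 : 0 ≤ ε) (h1 : ε ≤ 1)
    (hy : ∀ i ∈ s, ‖y i‖ ≤ ε) : ‖∏ i ∈ s, (1 + y i) - 1 - ∑ i ∈ s, y i‖ ≤ ε ^ 2 := by
  classical
  induction s using Finset.induction_on with
  | empty => simpa using by positivity
  | insert a s ha ih =>
    rw [Finset.forall_mem_insert] at hy
    have hsum : ‖∑ i ∈ s, y i‖ ≤ ε :=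
      IsUltrametricDist.norm_sum_le_of_forall_le_of_nonneg h0 hy.2
    have hone : ‖1 + y a‖ ≤ 1 :=
      (IsUltrametricDist.norm_add_le_max _ _).trans (max_le norm_one.le (hy.1.trans h1))
    have hsplit : (1 + y a) * ∏ i ∈ s, (1 + y i) - 1 - (y a + ∑ i ∈ s, y i) =
        (1 + y a) * (∏ i ∈ s, (1 + y i) - 1 - ∑ i ∈ s, y i) + y a * ∑ i ∈ s, y i := by ring
    rw [Finset.prod_insert ha, Finset.sum_insert ha, hsplit]
    refine (IsUltrametricDist.norm_add_le_max _ _).trans (max_le ?_ ?_)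
    · calc _ ≤ ‖1 + y a‖ * ‖∏ i ∈ s, (1 + y i) - 1 - ∑ i ∈ s, y i‖ := norm_mul_le _ _
        _ ≤ 1 * ε ^ 2 := by gcongr; exact ih hy.2
        _ = ε ^ 2 := one_mul _
    · calc _ ≤ ‖y a‖ * ‖∑ i ∈ s, y i‖ := norm_mul_le _ _
        _ ≤ ε * ε := by gcongr; exact hy.1
        _ = ε ^ 2 := (sq ε).symm

section SumInvSq

variable {N : ℕ} (hN : p ∣ N)

include hN

theorem norm_inv_mul_sub_of_mem_unitsBelow {j : ℕ} (hj : j ∈ unitsBelow p N) :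
    ‖((j : ℚ_[p]) * (N - j))⁻¹‖ = 1 := by
  rw [norm_inv, norm_mul, norm_of_mem_unitsBelow hj, norm_sub_of_mem_unitsBelow hN hj, one_mul,
    inv_one]

theorem two_mul_sum_inv_mul_sub_add_sumInvSq :
    2 * (∑ j ∈ unitsBelow p N, ((j : ℚ_[p]) * (N - j))⁻¹ + sumInvSq p N) =
      (N : ℚ_[p]) ^ 2 * ∑ j ∈ unitsBelow p N, ((j : ℚ_[p]) * (N - j))⁻¹ ^ 2 := by
  have hreflect := sum_unitsBelow_natCast_sub hN fun x : ℚ_[p] => (x ^ 2)⁻¹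
  rw [mul_add, two_mul (sumInvSq p N)]
  nth_rewrite 1 [sumInvSq]
  rw [← hreflect, sumInvSq, Finset.mul_sum, Finset.mul_sum, ← Finset.sum_add_distrib,
    ← Finset.sum_add_distrib]
  refine Finset.sum_congr rfl fun j hj => ?_
  have hj0 := ne_zero_of_mem_unitsBelow hj
  have hNj0 := sub_ne_zero_of_mem_unitsBelow hN hj
  field_simp
  ring

theorem norm_sum_inv_mul_sub_add_sumInvSq_le (hp2 : p ≠ 2) :
    ‖∑ j ∈ unitsBelow p N, ((j : ℚ_[p]) * (N - j))⁻¹ + sumInvSq p N‖ ≤ ‖(N : ℚ_[p])‖ ^ 2 := by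
  have hsum : ‖∑ j ∈ unitsBelow p N, ((j : ℚ_[p]) * (N - j))⁻¹ ^ 2‖ ≤ 1 :=
    IsUltrametricDist.norm_sum_le_of_forall_le_of_nonneg zero_le_one fun j hj => by
      rw [norm_pow, norm_inv_mul_sub_of_mem_unitsBelow hN hj, one_pow]
  have hnorm := congrArg norm (two_mul_sum_inv_mul_sub_add_sumInvSq hN)
  rw [norm_mul, norm_mul, norm_two_eq_one hp2, one_mul, norm_pow] at hnorm
  exact hnorm.trans_le (mul_le_of_le_one_right (by positivity) hsum)

theorem sq_prod_one_add_div :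
    (∏ j ∈ unitsBelow p N, (1 + (N : ℚ_[p]) / j)) ^ 2 =
      ∏ j ∈ unitsBelow p N, (1 + 2 * (N : ℚ_[p]) ^ 2 * ((j : ℚ_[p]) * (N - j))⁻¹) := by
  have hreflect := prod_unitsBelow_natCast_sub hN fun x : ℚ_[p] => 1 + N / x
  rw [sq]
  nth_rewrite 2 [← hreflect]
  rw [← Finset.prod_mul_distrib]
  refine Finset.prod_congr rfl fun j hj => ?_
  have hj0 := ne_zero_of_mem_unitsBelow hj
  have hNj0 := sub_ne_zero_of_mem_unitsBelow hN hj
  field_simp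
  ring

theorem norm_sq_prod_one_add_div_sub_le (hp2 : p ≠ 2) :
    ‖(∏ j ∈ unitsBelow p N, (1 + (N : ℚ_[p]) / j)) ^ 2 - 1 + 2 * (N : ℚ_[p]) ^ 2 * sumInvSq p N‖ ≤
      ‖(N : ℚ_[p])‖ ^ 4 := by
  have hnorm (x : ℚ_[p]) : ‖2 * (N : ℚ_[p]) ^ 2 * x‖ = ‖(N : ℚ_[p])‖ ^ 2 * ‖x‖ := by
    rw [norm_mul, norm_mul, norm_two_eq_one hp2, one_mul, norm_pow]
  have hprod := norm_prod_one_add_sub_one_sub_sum_le (unitsBelow p N) (ε := ‖(N : ℚ_[p])‖ ^ 2)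
    (y := fun j : ℕ => 2 * (N : ℚ_[p]) ^ 2 * ((j : ℚ_[p]) * (N - j))⁻¹) (by positivity)
    (pow_le_one₀ (norm_nonneg _) (IsUltrametricDist.norm_natCast_le_one _ N))
    fun j hj => by rw [hnorm, norm_inv_mul_sub_of_mem_unitsBelow hN hj, mul_one]
  have hsum : ‖2 * (N : ℚ_[p]) ^ 2 *
      (∑ j ∈ unitsBelow p N, ((j : ℚ_[p]) * (N - j))⁻¹ + sumInvSq p N)‖ ≤
      (‖(N : ℚ_[p])‖ ^ 2) ^ 2 := by
    rw [hnorm, sq (‖(N : ℚ_[p])‖ ^ 2)]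
    gcongr
    exact norm_sum_inv_mul_sub_add_sumInvSq_le hN hp2
  rw [← sq_prod_one_add_div hN, ← Finset.mul_sum] at hprod
  rw [show 4 = 2 * 2 from rfl, pow_mul]
  refine le_trans (le_of_eq ?_)
    ((IsUltrametricDist.norm_add_le_max _ _).trans (max_le hprod hsum))
  congr 1
  ring

theorem norm_sumInvSq_two_mul_sub_le :
    ‖sumInvSq p (2 * N) - 2 * sumInvSq p N‖ ≤ ‖(N : ℚ_[p])‖ := by
  rw [sumInvSq, sum_unitsBelow_two_mul hN, sumInvSq, two_mul, add_sub_add_left_eq_sub,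
    ← Finset.sum_sub_distrib]
  refine IsUltrametricDist.norm_sum_le_of_forall_le_of_nonneg (norm_nonneg _) fun j hj => ?_
  have hNj : ‖((N + j : ℕ) : ℚ_[p])‖ = 1 :=
    norm_natCast_eq_one_of_not_dvd (by simpa [Nat.dvd_add_right hN] using (mem_unitsBelow.1 hj).2)
  have hj0 := ne_zero_of_mem_unitsBelow hj
  have hNj0 : ((N + j : ℕ) : ℚ_[p]) ≠ 0 := norm_ne_zero_iff.1 (hNj ▸ one_ne_zero)
  have hdiff : (((N + j : ℕ) : ℚ_[p]) ^ 2)⁻¹ - ((j : ℚ_[p]) ^ 2)⁻¹ =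
      -((N : ℚ_[p]) * (N + 2 * j : ℕ)) / (((N + j : ℕ) : ℚ_[p]) ^ 2 * (j : ℚ_[p]) ^ 2) := by
    field_simp
    push_cast
    ring
  rw [hdiff, norm_div, norm_neg, norm_mul, norm_mul, norm_pow, norm_pow, hNj,
    norm_of_mem_unitsBelow hj, one_pow, mul_one, div_one]
  exact mul_le_of_le_one_right (norm_nonneg _) (IsUltrametricDist.norm_natCast_le_one _ _)

end SumInvSq

section Limits

variable (hp2 : p ≠ 2)

include hp2

theorem norm_sumInvSq_add_div_le {N : ℕ} (hN : p ∣ N) (hN0 : (N : ℚ_[p]) ≠ 0) :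
    ‖sumInvSq p N + (duplicationRatio (binomialTransform (dworkSeq p)) N ^ 2 - 1) /
      (2 * (N : ℚ_[p]) ^ 2)‖ ≤ ‖(N : ℚ_[p])‖ ^ 2 := by
  have hsplit : sumInvSq p N + (duplicationRatio (binomialTransform (dworkSeq p)) N ^ 2 - 1) /
      (2 * (N : ℚ_[p]) ^ 2) = (duplicationRatio (binomialTransform (dworkSeq p)) N ^ 2 - 1 +
        2 * (N : ℚ_[p]) ^ 2 * sumInvSq p N) / (2 * (N : ℚ_[p]) ^ 2) := by
    field_simp
    ring
  rw [hsplit, duplicationRatio_dworkSeq hp2 hN, norm_div, norm_mul 2, norm_two_eq_one hp2, one_mul,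
    norm_pow, div_le_iff₀ (pow_pos (norm_pos_iff.2 hN0) 2), ← pow_add]
  exact norm_sq_prod_one_add_div_sub_le hN hp2

theorem tendsto_sumInvSq_add_div_div :
    Tendsto (fun N : ℕ => (sumInvSq p N +
      (duplicationRatio (binomialTransform (dworkSeq p)) N ^ 2 - 1) / (2 * (N : ℚ_[p]) ^ 2)) / N)
      (padicZeroFilter p) (𝓝 0) := by
  refine squeeze_zero_norm' ?_ (tendsto_zero_iff_norm_tendsto_zero.1 tendsto_natCast_nhds_zero)
  filter_upwards [eventually_dvd, eventually_natCast_ne_zero] with N hN hN0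
  rw [norm_div, div_le_iff₀ (norm_pos_iff.2 hN0), ← sq]
  exact norm_sumInvSq_add_div_le hp2 hN hN0

theorem tendsto_sumInvSq :
    Tendsto (sumInvSq p) (padicZeroFilter p)
      (𝓝 (tailSum (dworkSeq p) 0 ^ 2 - 2 * (tailSum^[2] (dworkSeq p)) 0)) := by
  have hb := rapidDecay_dworkSeq (p := p)
  have hratio := tendsto_sq_sub_one_div (hb.tendsto_duplicationRatio dworkSeq_zero)
    (hb.tendsto_duplicationRatio_sub_one_div_sq dworkSeq_zero)
  have herr := (tendsto_sumInvSq_add_div_div hp2).mul (tendsto_natCast_nhds_zero (p := p))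
  refine ((herr.sub hratio).congr' ?_).trans_eq (by congr 1; ring)
  filter_upwards [eventually_natCast_ne_zero] with N hN0
  rw [div_mul_cancel₀ _ hN0, add_sub_cancel_right]

theorem two_mul_tailSum_tailSum_dworkSeq_zero :
    2 * (tailSum^[2] (dworkSeq p)) 0 = tailSum (dworkSeq p) 0 ^ 2 := by
  have hdiff : Tendsto (fun N => sumInvSq p (2 * N) - 2 * sumInvSq p N) (padicZeroFilter p)
      (𝓝 0) := by
    refine squeeze_zero_norm' ?_ (tendsto_zero_iff_norm_tendsto_zero.1 tendsto_natCast_nhds_zero)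
    filter_upwards [eventually_dvd] with N hN
    exact norm_sumInvSq_two_mul_sub_le hN
  have hS := tendsto_sumInvSq hp2
  have hlim := tendsto_nhds_unique hdiff
    ((hS.comp tendsto_two_mul_padicZeroFilter).sub (hS.const_mul 2))
  linear_combination -hlim

theorem tendsto_sumInvSq_div :
    Tendsto (fun N => sumInvSq p N / N) (padicZeroFilter p)
      (𝓝 (6 * (tailSum^[3] (dworkSeq p)) 0 - tailSum (dworkSeq p) 0 ^ 3)) := by
  have hb := rapidDecay_dworkSeq (p := p)
  have hratio := tendsto_sq_sub_one_div (hb.tendsto_duplicationRatio dworkSeq_zero)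
    (hb.tendsto_duplicationRatio_sub_one_div_cube dworkSeq_zero
      (two_mul_tailSum_tailSum_dworkSeq_zero hp2))
  refine (((tendsto_sumInvSq_add_div_div hp2).sub hratio).congr' ?_).trans_eq (by congr 1; ring)
  filter_upwards [eventually_natCast_ne_zero] with N hN0
  field_simp
  ring

end Limits

/-! ### Volkenborn sums of powers of the Teichmüller character -/

theorem norm_natCast_sub_teichmullerChar_lt_one (n : ℕ) :
    ‖(n : ℤ_[p]) - teichmullerChar p (n : ZMod p)‖ < 1 := by
  rw [← PadicInt.mem_nonunits]
  intro hunit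
  have hres := hunit.map ((WittVector.constantCoeff (p := p) (R := ZMod p)).comp
    (WittVector.equiv p).symm.toRingHom)
  have hsymm : (WittVector.equiv p).symm (teichmullerChar p (n : ZMod p)) =
      WittVector.teichmuller p (n : ZMod p) := (WittVector.equiv p).symm_apply_apply _
  have hcoeff : WittVector.constantCoeff (WittVector.teichmuller p (n : ZMod p)) = (n : ZMod p) :=
    WittVector.teichmuller_coeff_zero p _
  rw [map_sub, map_natCast, RingHom.comp_apply, RingEquiv.toRingHom_eq_coe, RingHom.coe_coe,
    hsymm, hcoeff, sub_self] at hres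
  exact not_isUnit_zero hres

theorem isUnit_natCast_zmod {n : ℕ} (hn : ¬ p ∣ n) : IsUnit (n : ZMod p) := by
  rwa [isUnit_iff_ne_zero, Ne, CharP.cast_eq_zero_iff (ZMod p) p]

theorem inv_teichmullerChar_mul {n : ℕ} (hn : ¬ p ∣ n) :
    (teichmullerChar p)⁻¹ (n : ZMod p) * teichmullerChar p (n : ZMod p) = 1 := by
  rw [← MulChar.mul_apply, inv_mul_cancel, MulChar.one_apply (isUnit_natCast_zmod hn)]

theorem teichmullerChar_zpow_neg_apply {n : ℕ} (hn : ¬ p ∣ n) (m : ℕ) :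
    (teichmullerChar p ^ (-m : ℤ)) (n : ZMod p) = (teichmullerChar p)⁻¹ (n : ZMod p) ^ m := by
  obtain ⟨u, hu⟩ := isUnit_natCast_zmod hn
  rw [zpow_neg, zpow_natCast, ← inv_pow, ← hu, MulChar.pow_apply_coe]

theorem norm_angle_sub_one_lt_one {n : ℕ} (hn : ¬ p ∣ n) : ‖angle p n - 1‖ < 1 := by
  have hfactor : angle p n - 1 = (teichmullerChar p)⁻¹ (n : ZMod p) *
      ((n : ℤ_[p]) - teichmullerChar p (n : ZMod p)) := by
    rw [angle, ← inv_teichmullerChar_mul hn]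
    ring
  rw [hfactor, norm_mul]
  exact (mul_le_of_le_one_left (norm_nonneg _) (PadicInt.norm_le_one _)).trans_lt
    (norm_natCast_sub_teichmullerChar_lt_one n)

theorem unitPow_neg_mul_pow {u : ℤ_[p]} (hu : ‖u - 1‖ < 1) (m : ℕ) :
    unitPow u (-m) * u ^ m = 1 := by
  have hpow : Tendsto ((u - 1) ^ · : ℕ → ℤ_[p]) atTop (𝓝 0) :=
    tendsto_pow_atTop_nhds_zero_of_norm_lt_one hu
  let κ : AddChar ℤ_[p] ℤ_[p] := PadicInt.addChar_of_value_at_one (u - 1) hpow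
  have hκ : unitPow u (-m) = κ (-m) := by
    rw [PadicInt.coe_addChar_of_value_at_one hpow, unitPow]
  have hκ_natCast : κ (m : ℤ_[p]) = u ^ m := by
    rw [← nsmul_one m, AddChar.map_nsmul_eq_pow, PadicInt.addChar_of_value_at_one_def hpow,
      add_sub_cancel]
  rw [hκ, ← hκ_natCast, ← AddChar.map_add_eq_mul, neg_add_cancel, AddChar.map_zero_eq_one]

theorem teichmullerChar_mul_unitPow_angle {n : ℕ} (hn : ¬ p ∣ n) (m : ℕ) :
    (((teichmullerChar p ^ (-m : ℤ)) (n : ZMod p) * unitPow (angle p n) (-m) : ℤ_[p]) : ℚ_[p]) =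
      ((n : ℚ_[p]) ^ m)⁻¹ := by
  have hmul : (teichmullerChar p ^ (-m : ℤ)) (n : ZMod p) * unitPow (angle p n) (-m) *
      (n : ℤ_[p]) ^ m = 1 := by
    rw [teichmullerChar_zpow_neg_apply hn, mul_right_comm, ← mul_pow, mul_comm _ (n : ℤ_[p]),
      ← angle, mul_comm, unitPow_neg_mul_pow (norm_angle_sub_one_lt_one hn)]
  refine eq_inv_of_mul_eq_one_left ?_
  exact_mod_cast congrArg (fun z : ℤ_[p] => (z : ℚ_[p])) hmul

theorem volkenbornSum_natCast_add_one (m k : ℕ) :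
    volkenbornSum p (m + 1) (teichmullerChar p ^ (-m : ℤ)) k =
      (∑ n ∈ unitsBelow p (p ^ (k + 1)), ((n : ℚ_[p]) ^ m)⁻¹) / (p ^ (k + 1) : ℕ) := by
  rw [volkenbornSum, filter_Icc_one_not_dvd (dvd_pow_self p k.succ_ne_zero), div_eq_inv_mul,
    Nat.cast_pow]
  congr 1
  refine Finset.sum_congr rfl fun n hn => ?_
  rw [sub_add_cancel_right, teichmullerChar_mul_unitPow_angle (mem_unitsBelow.1 hn).2]

/-! ### The values `L_p(3, ω⁻²)` and `ζ_p(3)` -/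

theorem Delta_three :
    Delta p 3 = (tailSum^[3] (dworkSeq p)) 0 - tailSum (dworkSeq p) 0 ^ 3 / 6 := by
  rw [Delta, constTerm_DxPowDwork, constTerm_DxPowDwork, Function.iterate_one]
  norm_num [Nat.factorial]

theorem tendsto_volkenbornSum_three (hp2 : p ≠ 2) :
    Tendsto (volkenbornSum p 3 (teichmullerChar p ^ (-2 : ℤ))) atTop (𝓝 (6 * Delta p 3)) := by
  have hsum : volkenbornSum p 3 (teichmullerChar p ^ (-2 : ℤ)) =
      fun k => sumInvSq p (p ^ (k + 1)) / (p ^ (k + 1) : ℕ) := by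
    funext k
    have hcast : (3 : ℤ_[p]) = (2 : ℕ) + 1 := by norm_num
    rw [hcast]
    exact volkenbornSum_natCast_add_one 2 k
  rw [hsum, Delta_three, mul_sub, mul_div_cancel₀ _ (by norm_num)]
  exact (tendsto_sumInvSq_div hp2).comp tendsto_prime_pow_padicZeroFilter

theorem kubotaLeopoldt_three (hp2 : p ≠ 2) :
    kubotaLeopoldt p 3 (teichmullerChar p ^ (-2 : ℤ)) = 3 * Delta p 3 := by
  have hcast : ((3 : ℤ_[p]) : ℚ_[p]) = 3 := PadicInt.coe_natCast 3
  rw [kubotaLeopoldt, (tendsto_volkenbornSum_three hp2).limUnder_eq, hcast]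
  ring

theorem kubotaLeopoldt_eq_mul_padicZeta {s : ℕ} (hs : s ≠ 0) :
    kubotaLeopoldt p s (teichmullerChar p ^ (1 - s : ℤ)) =
      (1 - 1 / (p : ℚ_[p]) ^ s) * padicZeta p s := by
  have hp : p.Prime := Fact.out
  have hps : (p : ℚ_[p]) ^ s ≠ 0 := pow_ne_zero s (Nat.cast_ne_zero.2 hp.ne_zero)
  have hps1 : (p : ℚ_[p]) ^ s - 1 ≠ 0 := by
    exact_mod_cast sub_ne_zero.2 (Nat.cast_ne_one (R := ℚ_[p]).2 (Nat.one_lt_pow hs hp.one_lt).ne')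
  rw [padicZeta, one_sub_div hps, ← mul_assoc, div_mul_div_cancel₀ hps, div_self hps1, one_mul]

end DworkGamma

/-- Evaluation of `Δ₃`. The first two conjuncts say that the infinite sums defining `D_x^s f` and
the limit defining `L_p(3, ω⁻²)` converge. -/
theorem mainTheorem1 (p : ℕ) [Fact p.Prime] (hp : p ≠ 2) :
    (∀ (s : ℕ) (n : ℤ), Summable fun i : ℕ =>
      (DworkGamma.pderiv^[i] (DworkGamma.divX (DworkGamma.DxPowDwork p s))) n) ∧
    (∃ l : ℚ_[p], Filter.Tendsto
      (DworkGamma.volkenbornSum p 3 (DworkGamma.teichmullerChar p ^ (-2 : ℤ)))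
      Filter.atTop (nhds l)) ∧
    DworkGamma.Delta p 3 =
      DworkGamma.kubotaLeopoldt p 3 (DworkGamma.teichmullerChar p ^ (-2 : ℤ)) / 3 ∧
    DworkGamma.Delta p 3 = (1 - 1 / (p : ℚ_[p]) ^ 3) * (DworkGamma.padicZeta p 3 / 3) ∧
    (p : ℚ_[p]) ^ 3 * (24 / 25) * DworkGamma.Delta p 3 =
      (p : ℚ_[p]) ^ 3 * (2 ^ 3 / 5 ^ 2) *
        DworkGamma.kubotaLeopoldt p 3 (DworkGamma.teichmullerChar p ^ (-2 : ℤ)) ∧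
    (p : ℚ_[p]) ^ 3 * (24 / 25) * DworkGamma.Delta p 3 =
      ((p : ℚ_[p]) ^ 3 - 1) * (2 ^ 3 / 5 ^ 2) * DworkGamma.padicZeta p 3 := by
  have hL := DworkGamma.kubotaLeopoldt_three hp
  have hΔL : DworkGamma.Delta p 3 =
      DworkGamma.kubotaLeopoldt p 3 (DworkGamma.teichmullerChar p ^ (-2 : ℤ)) / 3 := by
    rw [hL, mul_div_cancel_left₀ _ three_ne_zero]
  have hΔζ : DworkGamma.Delta p 3 =
      (1 - 1 / (p : ℚ_[p]) ^ 3) * (DworkGamma.padicZeta p 3 / 3) := by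
    rw [hΔL, mul_div_assoc', ← DworkGamma.kubotaLeopoldt_eq_mul_padicZeta three_ne_zero]
    norm_num
  refine ⟨fun s => ?_, ⟨_, DworkGamma.tendsto_volkenbornSum_three hp⟩, hΔL, hΔζ, ?_, ?_⟩
  · have hdecay := DworkGamma.rapidDecay_dworkSeq (p := p).iterate_tailSum s
    rw [← DworkGamma.laplaceCoeff_DxPowDwork] at hdecay
    exact hdecay.summable_iterate_pderiv
  · rw [hL]
    ring
  · have hp0 : (p : ℚ_[p]) ≠ 0 := Nat.cast_ne_zero.2 (Fact.out : p.Prime).ne_zero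
    rw [hΔζ]
    field_simp
    ring
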